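/- Let $k$ be a field of characteristic $0$ and $G$ a finite group. Let $X$ be a quasiprojective $G$-variety over $k$, i.e. an integral quasiprojective $k$-scheme with a faithful action of $G$ by $k$-automorphisms. For a closed point $x$, let $\operatorname{Stab}(x)$ be the group of those $g\in G$ with $gx=x$ that act trivially on the residue field $k(x)$; an action is called free on a subset if all closed points of that subset have trivial $\operatorname{Stab}$. Suppose that $X$ is generically free (the action is free on some nonempty $G$-invariant open subset) and in standard form with respect to a (reduced) divisor $Y$, i.e. (i) $X$ is smooth over $k$ and $Y$ is a normal crossing divisor: at each closed point, the irreducible components of $Y$ through that point are defined by distinct members of a local coordinate system; (ii) $G$ acts freely on $X-Y$; (iii) for every $g\in G$ and every irreducible component $Y_0$ of $Y$, either $g(Y_0)=Y_0$ or $g(Y_0)\cap Y_0=\emptyset$. Here a local coordinate system at $x$ is a family of elements of ${\mathfrak m}_x\subset{\mathcal O}_{x,X}$ whose classes form a $k(x)$-basis of ${\mathfrak m}_x/{\mathfrak m}_x^2$. Let $x$ be a closed point of $X$, let $Y_1,\dots,Y_m$ be the distinct irreducible components of $Y$ passing through $x$, and let $u_1,\dots,u_m,v_1,\dots,v_l$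 be a local coordinate system at $x$ such that (a) the class modulo ${\mathfrak m}_x^2$ of each $u_i$ and of each $v_j$ spans a one-dimensional $k(x)$-subspace of ${\mathfrak m}_x/{\mathfrak m}_x^2$ invariant under all $g\in G$ with $gx=x$; (b) for every $i$ and every $g\in G$, $u_i$ is a local equation of $g(Y_i)$ at $gx$ (i.e. $u_i$ is regular at $gx$ and generates the ideal of $g(Y_i)$ in ${\mathcal O}_{gx,X}$); (c) for every $j$ there are given integers $e_{j1},\dots,e_{jm}\ge 0$ such that $h_j=u_1^{e_{j1}}\cdots u_m^{e_{jm}}v_j$ is a $G$-invariant rational function on $X$. Put $w_i=\prod_{g\in G}g^*(u_i)$. Then the $w_i$ and $h_j$ are nonzero $G$-invariant rational functions on $X$, and for every nonzero rational function $f$ on $X$ whose divisor is supported on $Y$, $$\frac{df}{f}\in\mathcal M,$$ where $\mathcal M$ is the ${\mathcal O}_{x,X}$-submodule of the module $\Omega^1_{k(X)/k}$ of rational differential forms generated by $dw_i/w_i$ ($i=1,\dots,m$) and $dh_j/h_j$ ($j=1,\dots,l$). -/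

import Mathlib

open CategoryTheory AlgebraicGeometry

universe u v

noncomputable section

/-- Projective space `ℙⁿ` over a field `k`, as `Proj k[x₀, …, xₙ]`, with its structure morphism. -/
def projSpaceOver (k : Type u) [Field k] (n : ℕ) : Over (Spec (.of k)) :=
  letI := MvPolynomial.gradedAlgebra (σ := Fin (n + 1)) (R := k)
  Over.mk (Proj.toSpecZero (MvPolynomial.homogeneousSubmodule (Fin (n + 1)) k) ≫
    Spec.map (CommRingCat.ofHom
      (algebraMap k (MvPolynomial.homogeneousSubmodule (Fin (n + 1)) k 0))))

/-- A `G`-variety over `k`: an integral separated scheme of finite type over `k` with a faithful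
left action of `G` by automorphisms over `k`. (In `Aut X` the product `a * b` is "first `b`,
then `a`", so a homomorphism `G →* Aut X` is a left action.) -/
structure GVariety (k : Type u) [Field k] (G : Type v) [Group G] where
  X : Scheme.{u}
  π : X ⟶ Spec (.of k)
  isIntegral : IsIntegral X
  isSeparated : IsSeparated π
  locallyOfFiniteType : LocallyOfFiniteType π
  quasiCompact : QuasiCompact π
  act : G →* Aut X
  act_over : ∀ g, (act g).hom ≫ π = π
  faithful : Function.Injective act

/-- For `φ : X ⟶ X` with `φ x = y`, the pullback of germs `φ^* : 𝒪_{X,y} → 𝒪_{X,x}`. -/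
def germPullback {X : Scheme.{u}} (φ : X ⟶ X) {x y : X} (h : φ x = y) :
    X.presheaf.stalk y →+* X.presheaf.stalk x :=
  (X.presheaf.stalkSpecializes (specializes_of_eq h) ≫ φ.stalkMap x).hom

/-- The ideal in `𝒪_{X,y}` of the germs vanishing on the closed subset `Z`: the intersection of
the primes of `𝒪_{X,y}` (points of `X` specializing to `y`) that belong to `Z`. -/
def vanishingIdealAt {X : Scheme.{u}} (Z : Set X) (y : X) : Ideal (X.presheaf.stalk y) :=
  ⨅ z : {z : X // z ∈ Z ∧ z ⤳ y},
    (IsLocalRing.maximalIdeal (X.presheaf.stalk z.1)).comap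
      (X.presheaf.stalkSpecializes z.2.2).hom

/-- The irreducible components of a subset `Y` of a topological space `T`, as subsets of `T`. -/
def componentsOf {T : Type*} [TopologicalSpace T] (Y : Set T) : Set (Set T) :=
  {Z | Maximal (fun S => IsIrreducible S ∧ S ⊆ Y) Z}

/-- `t` is a local coordinate system at `x`: a family of elements of `𝔪_x` whose classes form a
basis of `𝔪_x/𝔪_x²` over the residue field. -/
def IsLocalCoordinateSystem {X : Scheme.{u}} (x : X) {ι : Type*}
    (t : ι → IsLocalRing.maximalIdeal (X.presheaf.stalk x)) : Prop :=
  LinearIndependent (IsLocalRing.ResidueField (X.presheaf.stalk x))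
      (fun i => (IsLocalRing.maximalIdeal (X.presheaf.stalk x)).toCotangent (t i) :
        ι → IsLocalRing.CotangentSpace (X.presheaf.stalk x)) ∧
    Submodule.span (IsLocalRing.ResidueField (X.presheaf.stalk x))
      (Set.range (fun i => (IsLocalRing.maximalIdeal (X.presheaf.stalk x)).toCotangent (t i) :
        ι → IsLocalRing.CotangentSpace (X.presheaf.stalk x))) = ⊤

/-- The closed subset `Y`, viewed as a reduced divisor, has normal crossings: at every closed point
`x`, the irreducible components of `Y` through `x` are defined by distinct members of a local
coordinate system at `x`. (So the components are smooth hypersurfaces meeting transversally.) -/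
def IsNormalCrossingDivisor {X : Scheme.{u}} (Y : Set X) : Prop :=
  IsClosed Y ∧ ∀ x : X, IsClosed ({x} : Set X) →
    ∃ (n : ℕ) (t : Fin n → IsLocalRing.maximalIdeal (X.presheaf.stalk x))
      (c : {Z : Set X // Z ∈ componentsOf Y ∧ x ∈ Z} → Fin n),
      IsLocalCoordinateSystem x t ∧ Function.Injective c ∧
      ∀ Z, Ideal.span {(t (c Z) : X.presheaf.stalk x)} = vanishingIdealAt Z.1 x

namespace GVariety

variable {k : Type u} [Field k] {G : Type v} [Group G] (V : GVariety k G)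

instance : IsIntegral V.X := V.isIntegral

instance : LocallyOfFiniteType V.π := V.locallyOfFiniteType

instance (g : G) : IsIso (V.act g).hom := Iso.isIso_hom (V.act g)

instance : IsLocallyNoetherian V.X := LocallyOfFiniteType.isLocallyNoetherian V.π

/-- The function field `k(X)` as a `k`-algebra. -/
instance : Algebra k V.X.functionField :=
  ((Scheme.ΓSpecIso (.of k)).inv ≫ V.π.appTop ≫
    V.X.presheaf.germ ⊤ (genericPoint V.X) trivial).hom.toAlgebra

/-- `X` is quasiprojective: it admits an immersion over `k` into some `ℙⁿ`. -/
def IsQuasiprojective : Prop :=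
  ∃ (n : ℕ) (i : V.X ⟶ (projSpaceOver k n).left),
    IsImmersion i ∧ i ≫ (projSpaceOver k n).hom = V.π

/-- `g` lies in the stabilizer `Stab(x)` (inertia group): `g x = x` and `g` acts trivially on the
residue field of `x`. -/
def MemStab (g : G) (x : V.X) : Prop :=
  ∃ h : (V.act g).hom x = x, ∀ s : V.X.presheaf.stalk x,
    germPullback (V.act g).hom h s - s ∈ IsLocalRing.maximalIdeal (V.X.presheaf.stalk x)

/-- `G` acts freely on the subset `U`: closed points in `U` have trivial stabilizers. -/
def IsFreeOn (U : Set V.X) : Prop :=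
  ∀ x ∈ U, IsClosed ({x} : Set V.X) → ∀ g : G, V.MemStab g x → g = 1

/-- `X` is a generically free `G`-variety in standard form with respect to the divisor `Y`. -/
structure IsStandardForm (Y : Set V.X) : Prop where
  generically_free : ∃ U : V.X.Opens, (U : Set V.X).Nonempty ∧
    (∀ g : G, ∀ x ∈ U, (V.act g).hom x ∈ U) ∧ V.IsFreeOn U
  smooth : Smooth V.π
  normal_crossing : IsNormalCrossingDivisor Y
  free : V.IsFreeOn Yᶜ
  components : ∀ g : G, ∀ Z ∈ componentsOf Y,
    (V.act g).hom '' Z = Z ∨ (V.act g).hom '' Z ∩ Z = ∅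

/-- The action `g^*` of `g` on rational functions, `g^*(φ) = φ ∘ g`. -/
def ratPullback (g : G) : V.X.functionField →+* V.X.functionField :=
  germPullback (V.act g).hom (genericPoint_eq_of_isOpenImmersion (V.act g).hom)

/-- The rational function on `X` defined by a germ at `x`. -/
def toRat (x : V.X) : V.X.presheaf.stalk x →+* V.X.functionField :=
  algebraMap (V.X.presheaf.stalk x) V.X.functionField

/-- The rational function `r` is a local equation of `Z` at `y`: it is regular at `y` and generates
the ideal of `Z` in `𝒪_{X,y}`. -/
def IsLocalEquation (r : V.X.functionField) (Z : Set V.X) (y : V.X) : Prop :=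
  ∃ t : V.X.presheaf.stalk y, V.toRat y t = r ∧ Ideal.span {t} = vanishingIdealAt Z y

/-- The class of `t ∈ 𝔪_x` in `𝔪_x/𝔪_x²` spans a `k(x)`-subspace that is invariant under all
`g ∈ G` with `g x = x`. -/
def SpansInvariantLine (x : V.X) (t : IsLocalRing.maximalIdeal (V.X.presheaf.stalk x)) : Prop :=
  ∀ (g : G) (h : (V.act g).hom x = x),
    ∃ t' : IsLocalRing.maximalIdeal (V.X.presheaf.stalk x),
      (t' : V.X.presheaf.stalk x) = germPullback (V.act g).hom h t ∧
      ((IsLocalRing.maximalIdeal (V.X.presheaf.stalk x)).toCotangent t' :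
          IsLocalRing.CotangentSpace (V.X.presheaf.stalk x)) ∈
        Submodule.span (IsLocalRing.ResidueField (V.X.presheaf.stalk x))
          {((IsLocalRing.maximalIdeal (V.X.presheaf.stalk x)).toCotangent t :
            IsLocalRing.CotangentSpace (V.X.presheaf.stalk x))}

/-- The rational function `h_j = u₁^{e_{j1}} ⋯ u_m^{e_{jm}} v_j`. -/
def hFun {x : V.X} {m l : ℕ} (u : Fin m → IsLocalRing.maximalIdeal (V.X.presheaf.stalk x))
    (v : Fin l → IsLocalRing.maximalIdeal (V.X.presheaf.stalk x)) (e : Fin l → Fin m → ℕ)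
    (j : Fin l) : V.X.functionField :=
  (∏ i, V.toRat x (u i) ^ e j i) * V.toRat x (v j)

/-- The rational function `w_i = ∏_{g ∈ G} g^*(u_i)`. -/
def wFun [Fintype G] {x : V.X} {m : ℕ}
    (u : Fin m → IsLocalRing.maximalIdeal (V.X.presheaf.stalk x)) (i : Fin m) :
    V.X.functionField :=
  ∏ g : G, V.ratPullback g (V.toRat x (u i))

/-- `u₁, …, u_m, v₁, …, v_l` is a local coordinate system at `x` adapted to the components
`Ys₁, …, Ys_m` of `Y` through `x` and to the `G`-action, with exponents `e_{ji}`. -/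
structure IsAdaptedCoordinateSystem (Y : Set V.X) (x : V.X) {m l : ℕ} (Ys : Fin m → Set V.X)
    (u : Fin m → IsLocalRing.maximalIdeal (V.X.presheaf.stalk x))
    (v : Fin l → IsLocalRing.maximalIdeal (V.X.presheaf.stalk x))
    (e : Fin l → Fin m → ℕ) : Prop where
  components_injective : Function.Injective Ys
  components_range : Set.range Ys = {Z | Z ∈ componentsOf Y ∧ x ∈ Z}
  coordinates : IsLocalCoordinateSystem x (Sum.elim u v)
  invariant_u : ∀ i, V.SpansInvariantLine x (u i)
  invariant_v : ∀ j, V.SpansInvariantLine x (v j)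
  local_equation : ∀ (i : Fin m) (g : G),
    V.IsLocalEquation (V.toRat x (u i)) ((V.act g).hom '' Ys i) ((V.act g).hom x)
  invariant_h : ∀ (j : Fin l) (g : G), V.ratPullback g (V.hFun u v e j) = V.hFun u v e j

/-- The divisor of the rational function `f` is supported on `Y`: every prime divisor (given by
its generic point `z`) along which `f` has nonzero order is contained in `Y`. -/
def DivisorSupportedOn (f : V.X.functionField) (Y : Set V.X) : Prop :=
  ∀ z : V.X, Order.coheight z = 1 → Scheme.ord f z ≠ 0 → z ∈ Y

/-- The logarithmic differential `df/f`, a rational differential form on `X`. -/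
def dlog (f : V.X.functionField) : Ω[V.X.functionField⁄k] :=
  f⁻¹ • KaehlerDifferential.D k V.X.functionField f

end GVariety

end

/-! Write `A` for the local ring at `x` and `𝔪` for its maximal ideal. By smoothness `A` is a
noetherian normal domain, and the `u i` are primes of `A` cutting out the components of `Y` through
`x`. A rational function with divisor supported on `Y` is therefore a unit of `A` times a monomial
in the `u i` (`IsIntegrallyClosed.exists_unit_mul_prod_zpow`). Condition (b) makes every `g^*(u i)`
a unit multiple of `u i`, so `w i` is a unit times `u i ^ |G|` (`exists_wFun_eq`).

Let `L` be the `A`-module generated by the logarithmic differentials of all coordinates. In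
characteristic zero the differentials of the coordinates generate `Ω[A⁄k]`
(`KaehlerDifferential.span_range_D_eq_top`), and `dt = t • dt/t`, so `dA ⊆ 𝔪L`; in particular `dc/c
∈ 𝔪L` for units `c`. Modulo `𝔪L`, `dw i/w i` is `|G|` times `du i/u i`, and `dh j/h j` is `dv j/v j`
plus an integral combination of the `du i/u i`. As `|G|` is invertible in `k`, `L ⊆ 𝓜 + 𝔪L`, and
Nakayama gives `L ⊆ 𝓜` (`logDifferential_mem_span`). Finally `df/f ∈ L`. -/

/-! ### Normality of smooth algebras, and divisors on normal domains. -/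

section Normality

open TensorProduct nonZeroDivisors

/-- A domain that is étale over an integrally closed domain is integrally closed. -/
theorem IsIntegrallyClosed.of_etale (P S : Type*) [CommRing P] [IsDomain P] [IsIntegrallyClosed P]
    [CommRing S] [IsDomain S] [Algebra P S] [Algebra.Etale P S] : IsIntegrallyClosed S := by
  let K := FractionRing P
  let T := S ⊗[P] K
  have hinj : Function.Injective (algebraMap P S) := FaithfulSMul.algebraMap_injective P S
  have hM : Algebra.algebraMapSubmonoid S P⁰ ≤ S⁰ := by
    rintro _ ⟨p, hp, rfl⟩
    exact mem_nonZeroDivisors_of_ne_zero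
      ((map_ne_zero_iff _ hinj).2 (nonZeroDivisors.ne_zero hp))
  have hloc : IsLocalization (Algebra.algebraMapSubmonoid S P⁰) T := inferInstance
  have : IsDomain T := IsLocalization.isDomain_of_le_nonZeroDivisors T hM
  have : IsDomain (K ⊗[P] S) := (Algebra.TensorProduct.comm P K S).toRingEquiv.toMulEquiv.isDomain
  have : Module.Finite K (K ⊗[P] S) := Algebra.FormallyUnramified.finite_of_free K (K ⊗[P] S)
  -- `T` is a domain finite over the field `K`, hence a field; being a localization of `S`, it is
  -- the fraction field of `S`.
  have hT : IsField T := (Algebra.TensorProduct.comm P S K).toMulEquiv.isField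
    (isField_of_isIntegral_of_isField' (R := K) (Field.toIsField K))
  let := hT.toField
  have : IsFractionRing S T := by
    refine IsLocalization.of_le (Algebra.algebraMapSubmonoid S P⁰) S⁰ hM fun r hr => ?_
    obtain ⟨y, hy⟩ := hT.mul_inv_cancel ((map_ne_zero_iff _
      (IsLocalization.injective T hM)).2 (nonZeroDivisors.ne_zero hr))
    exact IsUnit.of_mul_eq_one _ hy
  refine (isIntegrallyClosed_iff T).2 fun {x} hx => ?_
  -- Integral closure commutes with smooth base change: the integral closure of `S` in `S ⊗ K` comes
  -- from `S ⊗` (integral closure of `P` in `K`), and the latter closure is `P`.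
  obtain ⟨y, hy⟩ := (TensorProduct.toIntegralClosure_bijective_of_smooth
    (R := P) (S := S) (B := K)).2 ⟨x, hx⟩
  replace hy := congr_arg Subtype.val hy
  simp only at hy
  rw [← hy]
  clear hy
  induction y with
  | zero => exact ⟨0, by simp⟩
  | add a b ha hb =>
    obtain ⟨a', ha⟩ := ha
    obtain ⟨b', hb⟩ := hb
    exact ⟨a' + b', by rw [map_add, ha, hb, map_add]; rfl⟩
  | tmul s b =>
    obtain ⟨c, hc⟩ := (isIntegrallyClosed_iff K).1 ‹_› b.2
    refine ⟨c • s, ?_⟩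
    change (c • s) ⊗ₜ[P] (1 : K) = s ⊗ₜ[P] (b : K)
    rw [← hc, TensorProduct.smul_tmul, Algebra.algebraMap_eq_smul_one]

/-- Presents the ideal of denominators of `y` as the annihilator of its class in `K/A`, so that
associated primes of `K/A` become available. -/
theorem mem_colon_range_algebraMap {A K : Type*} [CommRing A] [CommRing K] [Algebra A K]
    (y : K) (a : A) :
    a ∈ (⊥ : Submodule A (K ⧸ LinearMap.range (Algebra.linearMap A K))).colon
      {Submodule.Quotient.mk y} ↔ ∃ b, algebraMap A K b = a • y := by
  rw [Submodule.mem_colon_singleton, Submodule.mem_bot, ← Submodule.Quotient.mk_smul,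
    Submodule.Quotient.mk_eq_zero]
  rfl

/-- A domain that is smooth over a field is integrally closed. -/
theorem IsIntegrallyClosed.of_smooth (k S : Type*) [Field k]
    [CommRing S] [IsDomain S] [Algebra k S] [Algebra.Smooth k S] : IsIntegrallyClosed S := by
  refine (isIntegrallyClosed_iff (FractionRing S)).2 fun {x} hx => ?_
  -- `I` is the ideal of denominators of `x`. If it lay in a maximal ideal `p`, some `S[1/f]` with
  -- `f ∉ p` would be étale over a polynomial ring, hence normal and containing `x`, so a power of
  -- `f` would lie in `I ⊆ p`.
  let I : Ideal S := (⊥ : Submodule S (FractionRing S ⧸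
    LinearMap.range (Algebra.linearMap S (FractionRing S)))).colon {Submodule.Quotient.mk x}
  have hI (a : S) : a ∈ I ↔ ∃ b, algebraMap S (FractionRing S) b = a • x :=
    mem_colon_range_algebraMap x a
  suffices I = ⊤ by simpa [this] using hI 1
  by_contra hne
  obtain ⟨p, hp, hle⟩ := Ideal.exists_le_maximal I hne
  have : Algebra.IsSmoothAt k p := by
    have := Algebra.smoothLocus_eq_univ (R := k) (A := S)
    exact (this ▸ Set.mem_univ _ : (⟨p, hp.isPrime⟩ : PrimeSpectrum S) ∈ Algebra.smoothLocus k S)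
  obtain ⟨f, hfp, n, _, _, _⟩ :=
    Algebra.IsSmoothAt.exists_isStandardEtale_mvPolynomial (R := k) (p := p)
  have hf0 : f ≠ 0 := fun h => hfp (h ▸ p.zero_mem)
  have hM : Submonoid.powers f ≤ S⁰ := powers_le_nonZeroDivisors_of_noZeroDivisors hf0
  have : IsDomain (Localization.Away f) := IsLocalization.isDomain_localization hM
  have : IsIntegrallyClosed (Localization.Away f) :=
    .of_etale (MvPolynomial (Fin n) k) (Localization.Away f)
  let : Algebra (Localization.Away f) (FractionRing S) :=
    (IsLocalization.lift (M := Submonoid.powers f) (g := algebraMap S (FractionRing S))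
      fun y => IsLocalization.map_units (M := S⁰) _ ⟨y, hM y.2⟩).toAlgebra
  have : IsScalarTower S (Localization.Away f) (FractionRing S) :=
    .of_algebraMap_eq fun y => by
      rw [RingHom.algebraMap_toAlgebra, IsLocalization.lift_eq]
  have : IsFractionRing (Localization.Away f) (FractionRing S) :=
    IsFractionRing.isFractionRing_of_isDomain_of_isLocalization (Submonoid.powers f) _ _
  obtain ⟨y, hy⟩ := (isIntegrallyClosed_iff (FractionRing S)).1
    ‹IsIntegrallyClosed (Localization.Away f)› hx.tower_top
  obtain ⟨⟨a, ⟨_, m, rfl⟩⟩, ha⟩ := IsLocalization.surj (Submonoid.powers f) y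
  have := hle ((hI (f ^ m)).2 ⟨a, by
    rw [IsScalarTower.algebraMap_apply S (Localization.Away f) (FractionRing S), ← ha, map_mul,
      hy, ← IsScalarTower.algebraMap_apply, mul_comm, Algebra.smul_def]⟩)
  exact hfp (hp.isPrime.mem_of_pow_mem _ this)

/-- An element of the fraction field of a noetherian integrally closed domain is integral if it is
so at every prime of height one. -/
theorem IsIntegrallyClosed.mem_range_of_forall_height_eq_one {A K : Type*} [CommRing A] [IsDomain A]
    [IsNoetherianRing A] [IsIntegrallyClosed A] [Field K] [Algebra A K] [IsFractionRing A K]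
    (g : K) (hg : ∀ p : Ideal A, p.IsPrime → p.height = 1 →
      ∃ b ∉ p, b • g ∈ (algebraMap A K).range) :
    g ∈ (algebraMap A K).range := by
  let R : Submodule A K := LinearMap.range (Algebra.linearMap A K)
  by_contra hgR
  have hg0 : (Submodule.Quotient.mk g : K ⧸ R) ≠ 0 := by
    rw [Ne, Submodule.Quotient.mk_eq_zero]
    exact hgR
  -- If `g ∉ A`, its denominators lie in an associated prime `p` of `K/A`, the ideal of denominators
  -- of some `y`. Once `p` has height one, `hg` is contradicted.
  obtain ⟨p, hp, hle⟩ := exists_le_isAssociatedPrime_of_isNoetherianRing A _ hg0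
  obtain ⟨hprime, y, hy⟩ := (Submodule.isAssociatedPrime_iff (N := ⊥)).1 hp
  obtain ⟨y, rfl⟩ := Submodule.Quotient.mk_surjective _ y
  replace hy (a : A) : a ∈ p ↔ ∃ b, algebraMap A K b = a • y := by
    rw [hy, mem_colon_range_algebraMap]
  have hyR : ¬ ∃ b, algebraMap A K b = y := fun ⟨b, hb⟩ =>
    hprime.ne_top ((Ideal.eq_top_iff_one _).2 ((hy 1).2 ⟨b, by rw [hb, one_smul]⟩))
  have hp0 : p ≠ ⊥ := by
    obtain ⟨a, b, hb, rfl⟩ := IsFractionRing.div_surjective (A := A) y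
    have hb0 : b ≠ 0 := nonZeroDivisors.ne_zero hb
    have hb0' : algebraMap A K b ≠ 0 := (map_ne_zero_iff _ (IsFractionRing.injective A K)).2 hb0
    have hbp : b ∈ p := (hy b).2 ⟨a, by rw [Algebra.smul_def]; field_simp⟩
    exact fun h => hb0 (by simpa [h] using hbp)
  suffices h1 : p.height = 1 by
    obtain ⟨b, hb, c, hc⟩ := hg p hprime h1
    exact hb (hle ((mem_colon_range_algebraMap g b).2 ⟨c, hc⟩))
  -- Otherwise `y • p ⊆ p` with `p` finitely generated and nonzero, so `y` is integral over `A` and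
  -- lies in `A`.
  have hex : ∃ t ∈ p, ∃ s ∉ p, algebraMap A K s = t • y := by
    by_contra! hcon
    refine hyR ((isIntegrallyClosed_iff K).1 ‹_› ?_)
    refine isIntegral_of_smul_mem_submodule (M := K) (Submodule.map (Algebra.linearMap A K) p) ?_
      ((IsNoetherian.noetherian p).map _) y ?_
    · obtain ⟨z, hz, hz0⟩ := Submodule.exists_mem_ne_zero_of_ne_bot hp0
      exact Submodule.ne_bot_iff _ |>.2 ⟨_, ⟨z, hz, rfl⟩,
        (map_ne_zero_iff _ (IsFractionRing.injective A K)).2 hz0⟩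
    · rintro _ ⟨t, ht, rfl⟩
      obtain ⟨s, hs⟩ := (hy t).1 ht
      refine ⟨s, by_contra fun h => hcon t ht s h hs, ?_⟩
      rw [Algebra.linearMap_apply, Algebra.linearMap_apply, hs, Algebra.smul_def, smul_eq_mul,
        mul_comm]
  obtain ⟨t, ht, s, hs, hst⟩ := hex
  -- For `a ∈ p` with `a • y = r` one gets `s * a = r * t`; since `s ∉ p`, any prime inside `p`
  -- containing `t` contains `a`. Krull's principal ideal theorem then bounds the height.
  have hmin : p ∈ (Ideal.span {t}).minimalPrimes := by
    refine ⟨⟨hprime, (Ideal.span_singleton_le_iff_mem _).2 ht⟩, fun q ⟨hq, htq⟩ hqp a ha => ?_⟩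
    obtain ⟨r, hr⟩ := (hy a).1 ha
    have hsa : s * a = r * t := IsFractionRing.injective A K (by
      rw [map_mul, map_mul, hst, hr, Algebra.smul_def, Algebra.smul_def]; ring)
    refine (hq.mem_or_mem (hsa ▸ q.mul_mem_left r ?_ : s * a ∈ q)).resolve_left
      fun h => hs (hqp h)
    exact (Ideal.span_singleton_le_iff_mem _).1 htq
  refine le_antisymm (Ideal.height_le_one_of_isPrincipal_of_mem_minimalPrimes _ p hmin) ?_
  rw [Order.one_le_iff_ne_zero, Ne, Ideal.height_eq_zero_iff_eq_bot]
  exact hp0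

/-- Maximal powers are extracted one prime at a time. Each new cofactor divides the previous one, so
non-divisibility by the earlier primes persists, even if some `u i` are associated. -/
theorem exists_eq_mul_prod_pow_of_prime {A ι : Type*} [CommRing A] [IsDomain A]
    [IsNoetherianRing A] (u : ι → A) (hu : ∀ i, Prime (u i)) (s : Finset ι) (a : A) (ha : a ≠ 0) :
    ∃ (b : A) (n : ι → ℕ), a = b * ∏ i ∈ s, u i ^ n i ∧ ∀ i ∈ s, ¬ u i ∣ b := by
  classical
  induction s using Finset.induction_on with
  | empty => exact ⟨a, 0, by simp⟩
  | insert i s hi ih =>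
    obtain ⟨b, n, rfl, hb⟩ := ih
    have hb0 : b ≠ 0 := left_ne_zero_of_mul ha
    obtain ⟨r, c, hc, rfl⟩ := WfDvdMonoid.max_power_factor hb0 (hu i).irreducible
    refine ⟨c, Function.update n i r, ?_, ?_⟩
    · rw [Finset.prod_insert hi]
      have : ∏ j ∈ s, u j ^ Function.update n i r j = ∏ j ∈ s, u j ^ n j :=
        Finset.prod_congr rfl fun j hj => by
          rw [Function.update_of_ne (ne_of_mem_of_not_mem hj hi)]
      rw [this, Function.update_self]; ring
    · intro j hj hdvd
      rcases Finset.mem_insert.1 hj with rfl | hj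
      · exact hc hdvd
      · exact hb j hj (hdvd.mul_left _)

/-- A rational function on a noetherian integrally closed domain whose divisor is supported on the
prime divisors `u i = 0` is, up to a unit, a monomial in the `u i`. -/
theorem IsIntegrallyClosed.exists_unit_mul_prod_zpow {A K ι : Type*} [CommRing A] [IsDomain A]
    [IsNoetherianRing A] [IsIntegrallyClosed A] [Field K] [Algebra A K] [IsFractionRing A K]
    [Fintype ι] (u : ι → A) (hu : ∀ i, Prime (u i)) (f : K) (hf : f ≠ 0)
    (H : ∀ p : Ideal A, p.IsPrime → p.height = 1 → (∀ i, u i ∉ p) →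
      ∃ a ∉ p, ∃ b ∉ p, algebraMap A K b * f = algebraMap A K a) :
    ∃ (c : Aˣ) (n : ι → ℤ), f = algebraMap A K c * ∏ i, algebraMap A K (u i) ^ n i := by
  obtain ⟨a, b, hb, rfl⟩ := IsFractionRing.div_surjective (A := A) f
  have hb0 := nonZeroDivisors.ne_zero hb
  have ha0 : a ≠ 0 := by rintro rfl; simp at hf
  obtain ⟨a', α, rfl, ha'⟩ := exists_eq_mul_prod_pow_of_prime u hu Finset.univ a ha0
  obtain ⟨b', β, rfl, hb'⟩ := exists_eq_mul_prod_pow_of_prime u hu Finset.univ b hb0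
  have hinj := IsFractionRing.injective A K
  have hne {z : A} (hz : z ≠ 0) : algebraMap A K z ≠ 0 := (map_ne_zero_iff _ hinj).2 hz
  have ha0' := hne (left_ne_zero_of_mul ha0)
  have hb0' := hne (left_ne_zero_of_mul hb0)
  have hu0 (i : ι) : algebraMap A K (u i) ≠ 0 := hne (hu i).ne_zero
  set g : K := algebraMap A K a' / algebraMap A K b' with hg
  -- `g` is a unit at every prime of height one: if `u i ∈ p`, then `p = (u i)` contains neither
  -- `a'` nor `b'`; otherwise the monomials are units at `p` and `H` applies. Hence `g` and `g⁻¹`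
  -- both lie in `A`.
  have key (p : Ideal A) (hp : p.IsPrime) (h1 : p.height = 1) :
      ∃ s ∉ p, ∃ t ∉ p, algebraMap A K s * g = algebraMap A K t := by
    by_cases hup : ∃ i, u i ∈ p
    · obtain ⟨i, hi⟩ := hup
      have hpi := Ideal.eq_span_singleton_of_height_eq_one h1 hi (hu i)
      refine ⟨b', ?_, a', ?_, by rw [hg]; field_simp⟩
      · rw [hpi, Ideal.mem_span_singleton]; exact hb' i (Finset.mem_univ _)
      · rw [hpi, Ideal.mem_span_singleton]; exact ha' i (Finset.mem_univ _)
    · push Not at hup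
      have hmon (n : ι → ℕ) : ∏ i, u i ^ n i ∉ p := fun h => by
        obtain ⟨i, -, hi⟩ := (hp.prod_mem_iff).1 h
        exact hup i (hp.mem_of_pow_mem _ hi)
      obtain ⟨t, ht, s, hs, hst⟩ := H p hp h1 hup
      refine ⟨s * ∏ i, u i ^ α i, hp.mul_notMem hs (hmon α), t * ∏ i, u i ^ β i,
        hp.mul_notMem ht (hmon β), ?_⟩
      have hβ : algebraMap A K (∏ i, u i ^ β i) ≠ 0 := hne (right_ne_zero_of_mul hb0)
      rw [map_mul, map_mul, ← hst, hg, map_mul, map_mul]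
      field_simp
  obtain ⟨c, hc⟩ := mem_range_of_forall_height_eq_one g fun p hp h1 => by
    obtain ⟨s, hs, t, -, hst⟩ := key p hp h1
    exact ⟨s, hs, t, by rw [Algebra.smul_def, hst]⟩
  obtain ⟨d, hd⟩ := mem_range_of_forall_height_eq_one g⁻¹ fun p hp h1 => by
    obtain ⟨s, -, t, ht, hst⟩ := key p hp h1
    refine ⟨t, ht, s, ?_⟩
    have hg0 : g ≠ 0 := div_ne_zero ha0' hb0'
    rw [Algebra.smul_def, ← hst]
    field_simp
  have hcd : c * d = 1 := hinj (by
    rw [map_mul, hc, hd, map_one, mul_inv_cancel₀ (div_ne_zero ha0' hb0')])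
  refine ⟨⟨c, d, hcd, by rw [mul_comm, hcd]⟩, fun i => (α i : ℤ) - β i, ?_⟩
  simp only [map_mul, map_prod, map_pow, hc, zpow_sub₀ (hu0 _), zpow_natCast,
    Finset.prod_div_distrib]
  rw [hg]
  ring

end Normality

/-! ### Differentials of local rings and logarithmic differentials. -/

section Differentials

open IsLocalRing KaehlerDifferential

/-- Over a field of characteristic zero, the differentials of generators of the cotangent space
generate the module of differentials of a local ring with algebraic residue field. -/
theorem KaehlerDifferential.span_range_D_eq_top {k A ι : Type*} [Field k] [CharZero k]
    [CommRing A] [IsLocalRing A] [Algebra k A] [Algebra.EssFiniteType k A]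
    [Algebra.IsAlgebraic k (ResidueField A)] (t : ι → maximalIdeal A)
    (ht : Submodule.span (ResidueField A)
      (Set.range fun i => ((maximalIdeal A).toCotangent (t i) : CotangentSpace A)) = ⊤) :
    Submodule.span A (Set.range fun i => D k A (t i)) = ⊤ := by
  have : IsNoetherianRing A := Algebra.EssFiniteType.isNoetherianRing k A
  rw [Set.range_comp' (maximalIdeal A).toCotangent t, CotangentSpace.span_image_eq_top_iff] at ht
  set N := Submodule.span A (Set.range fun i => D k A (t i)) with hN
  -- By Nakayama it suffices that every `D a` lies in `Q`.
  let Q := N ⊔ maximalIdeal A • (⊤ : Submodule A Ω[A⁄k])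
  have hm (a : A) (ha : a ∈ maximalIdeal A) : D k A a ∈ Q := by
    have hspan : (⟨a, ha⟩ : maximalIdeal A) ∈ Submodule.span A (Set.range t) := by
      rw [ht]; exact Submodule.mem_top
    suffices H : ∀ b : maximalIdeal A, b ∈ Submodule.span A (Set.range t) → D k A (b : A) ∈ Q by
      exact H ⟨a, ha⟩ hspan
    intro b hb
    induction hb using Submodule.span_induction with
    | mem b hb =>
      obtain ⟨i, rfl⟩ := hb
      exact Submodule.mem_sup_left (Submodule.subset_span ⟨i, rfl⟩)
    | zero => simp
    | add b c _ _ hb hc => simpa using add_mem hb hc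
    | smul r b _ hb =>
      rw [Submodule.coe_smul, smul_eq_mul, Derivation.leibniz]
      exact add_mem (Q.smul_mem _ hb)
        (Submodule.mem_sup_right (Submodule.smul_mem_smul b.2 trivial))
  -- With `P` the minimal polynomial of the residue of `a`, `P(a) ∈ 𝔪` and `d(P(a)) = P'(a) da`.
  -- Characteristic zero makes `P` separable, so `P'(a)` is a unit.
  have hD (a : A) : D k A a ∈ Q := by
    have hint : IsIntegral k (residue A a) := Algebra.IsIntegral.isIntegral _
    let P := minpoly k (residue A a)
    have h0 : Polynomial.aeval a P ∈ maximalIdeal A := by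
      rw [← residue_eq_zero_iff]
      have := minpoly.aeval k (residue A a)
      rwa [← ResidueField.algebraMap_eq, Polynomial.aeval_algebraMap_apply,
        ResidueField.algebraMap_eq] at this
    have h1 : IsUnit (Polynomial.aeval a P.derivative) := by
      rw [← residue_ne_zero_iff_isUnit]
      have := (minpoly.irreducible hint).separable.aeval_derivative_ne_zero
        (minpoly.aeval k (residue A a))
      rwa [← ResidueField.algebraMap_eq, Polynomial.aeval_algebraMap_apply,
        ResidueField.algebraMap_eq] at this
    have := hm _ h0
    rw [Derivation.map_aeval] at this
    obtain ⟨w, hw⟩ := h1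
    rw [← hw] at this
    simpa [smul_smul] using Q.smul_mem (↑w⁻¹ : A) this
  rw [eq_top_iff]
  refine Submodule.le_of_le_smul_of_le_jacobson_bot (I := maximalIdeal A) Module.Finite.fg_top
    (IsLocalRing.jacobson_eq_maximalIdeal _ bot_ne_top).ge ?_
  rw [← span_range_derivation, Submodule.span_le]
  rintro _ ⟨a, rfl⟩
  rw [span_range_derivation]
  exact hD a

/-- The logarithmic differential `df/f` of an element of a field. -/
noncomputable def logDifferential (k : Type*) {K : Type*} [CommRing k] [Field K] [Algebra k K]
    (f : K) : Ω[K⁄k] :=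
  f⁻¹ • D k K f

section LogDifferential

variable (k : Type*) {K : Type*} [CommRing k] [Field K] [Algebra k K]

theorem logDifferential_one : logDifferential k (1 : K) = 0 := by
  simp [logDifferential]

theorem logDifferential_mul {f g : K} (hf : f ≠ 0) (hg : g ≠ 0) :
    logDifferential k (f * g) = logDifferential k f + logDifferential k g := by
  simp only [logDifferential, Derivation.leibniz, smul_add, smul_smul]
  rw [add_comm]
  congr 2 <;> field_simp

theorem logDifferential_inv (f : K) : logDifferential k f⁻¹ = - logDifferential k f := by
  rcases eq_or_ne f 0 with rfl | hf
  · simp [logDifferential]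
  have := logDifferential_mul k hf (inv_ne_zero hf)
  rw [mul_inv_cancel₀ hf, logDifferential_one] at this
  exact (neg_eq_of_add_eq_zero_right this.symm).symm

theorem logDifferential_pow {f : K} (hf : f ≠ 0) (n : ℕ) :
    logDifferential k (f ^ n) = n • logDifferential k f := by
  induction n with
  | zero => simp [logDifferential_one]
  | succ n ih => rw [pow_succ, logDifferential_mul k (pow_ne_zero n hf) hf, ih, succ_nsmul]

theorem logDifferential_zpow {f : K} (hf : f ≠ 0) (n : ℤ) :
    logDifferential k (f ^ n) = n • logDifferential k f := by
  cases n with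
  | ofNat n => simpa using logDifferential_pow k hf n
  | negSucc n =>
    rw [zpow_negSucc, logDifferential_inv, logDifferential_pow k hf, negSucc_zsmul]

theorem logDifferential_prod {ι : Type*} (s : Finset ι) (f : ι → K) (hf : ∀ i ∈ s, f i ≠ 0) :
    logDifferential k (∏ i ∈ s, f i) = ∑ i ∈ s, logDifferential k (f i) := by
  classical
  induction s using Finset.induction_on with
  | empty => simp [logDifferential_one]
  | insert i s hi ih =>
    have hs : ∀ j ∈ s, f j ≠ 0 := fun j hj => hf j (Finset.mem_insert_of_mem hj)
    rw [Finset.prod_insert hi, Finset.sum_insert hi, logDifferential_mul k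
      (hf i (Finset.mem_insert_self i s)) (Finset.prod_ne_zero_iff.2 hs), ih hs]

theorem smul_logDifferential {f : K} (hf : f ≠ 0) : f • logDifferential k f = D k K f := by
  rw [logDifferential, smul_smul, mul_inv_cancel₀ hf, one_smul]

end LogDifferential

/-- Let `u`, `v` be local coordinates. The logarithmic differential of a monomial in `u` times a
unit lies in the module generated by the logarithmic differentials of `u ^ N` times units and of
monomials in `u` times `v`. -/
theorem logDifferential_mem_span {k A K ι κ : Type*} [Field k] [CharZero k]
    [CommRing A] [IsDomain A] [IsLocalRing A] [Algebra k A] [Algebra.EssFiniteType k A]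
    [Algebra.IsAlgebraic k (ResidueField A)]
    [Field K] [Algebra A K] [IsFractionRing A K] [Algebra k K] [IsScalarTower k A K]
    [Fintype ι] [Finite κ] (u : ι → maximalIdeal A) (v : κ → maximalIdeal A)
    (hu : ∀ i, (u i : A) ≠ 0) (hv : ∀ j, (v j : A) ≠ 0)
    (ht : Submodule.span (ResidueField A)
      (Set.range fun i => ((maximalIdeal A).toCotangent (Sum.elim u v i) : CotangentSpace A)) = ⊤)
    {N : ℕ} (hN : N ≠ 0) (c : ι → Aˣ) (e : κ → ι → ℕ) (d : Aˣ) (n : ι → ℤ) :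
    logDifferential k (algebraMap A K d * ∏ i, algebraMap A K (u i) ^ n i) ∈
      Submodule.span A
        (Set.range (fun i => logDifferential k (algebraMap A K (c i) * algebraMap A K (u i) ^ N)) ∪
          Set.range (fun j => logDifferential k
            ((∏ i, algebraMap A K (u i) ^ e j i) * algebraMap A K (v j)))) := by
  have hne {z : A} (hz : z ≠ 0) : algebraMap A K z ≠ 0 :=
    (map_ne_zero_iff _ (IsFractionRing.injective A K)).2 hz
  set M := Submodule.span A
        (Set.range (fun i => logDifferential k (algebraMap A K (c i) * algebraMap A K (u i) ^ N)) ∪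
          Set.range (fun j => logDifferential k
            ((∏ i, algebraMap A K (u i) ^ e j i) * algebraMap A K (v j)))) with hM
  let t : ι ⊕ κ → maximalIdeal A := Sum.elim u v
  have ht0 (i) : algebraMap A K (t i) ≠ 0 := hne (by rcases i with i | j <;> simp [t, hu, hv])
  let L := Submodule.span A (Set.range fun i => logDifferential k (algebraMap A K (t i)))
  -- The factor `𝔪` comes from `dt = t • dt/t` with `t ∈ 𝔪`.
  have hD (a : A) : D k K (algebraMap A K a) ∈ maximalIdeal A • L := by
    rw [← KaehlerDifferential.map_D k k A K a]
    have : D k A a ∈ Submodule.span A (Set.range fun i => D k A (t i)) := by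
      rw [span_range_D_eq_top t ht]; trivial
    have := Submodule.mem_map_of_mem (f := KaehlerDifferential.map k k A K) this
    rw [Submodule.map_span] at this
    refine (Submodule.span_le.2 ?_) this
    rintro _ ⟨_, ⟨i, rfl⟩, rfl⟩
    rw [KaehlerDifferential.map_D, ← smul_logDifferential k (ht0 i), algebraMap_smul]
    exact Submodule.smul_mem_smul (t i).2 (Submodule.subset_span ⟨i, rfl⟩)
  have hunit (a : Aˣ) : logDifferential k (algebraMap A K a) ∈ maximalIdeal A • L := by
    have : logDifferential k (algebraMap A K a) =
        (↑a⁻¹ : A) • D k K (algebraMap A K a) := by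
      rw [logDifferential, ← algebraMap_smul K (↑a⁻¹ : A), map_units_inv]
    rw [this]
    exact Submodule.smul_mem _ _ (hD a)
  -- The unit `c i` contributes only to `𝔪L`, and `N` is invertible in `k`.
  have hLu (i : ι) : logDifferential k (algebraMap A K (u i)) ∈ M ⊔ maximalIdeal A • L := by
    have h1 : logDifferential k (algebraMap A K (c i) * algebraMap A K (u i) ^ N) ∈ M :=
      Submodule.subset_span (Or.inl ⟨i, rfl⟩)
    rw [logDifferential_mul k (hne (c i).ne_zero) (pow_ne_zero _ (hne (hu i))),
      logDifferential_pow k (hne (hu i))] at h1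
    have h2 : N • logDifferential k (algebraMap A K (u i)) ∈ M ⊔ maximalIdeal A • L := by
      rw [← add_sub_cancel_left (logDifferential k (algebraMap A K (c i)))
        (N • logDifferential k (algebraMap A K (u i)))]
      exact sub_mem (Submodule.mem_sup_left h1) (Submodule.mem_sup_right (hunit _))
    have h3 := Submodule.smul_mem _ (algebraMap k A (N : k)⁻¹) h2
    rwa [← Nat.cast_smul_eq_nsmul k, ← algebraMap_smul A (N : k), smul_smul, ← map_mul,
      inv_mul_cancel₀ (Nat.cast_ne_zero.2 hN), map_one, one_smul] at h3
  have hL : L ≤ M ⊔ maximalIdeal A • L := by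
    rw [Submodule.span_le]
    rintro _ ⟨i | j, rfl⟩
    · exact hLu i
    · have h1 : logDifferential k ((∏ i, algebraMap A K (u i) ^ e j i) * algebraMap A K (v j)) ∈ M :=
        Submodule.subset_span (Or.inr ⟨j, rfl⟩)
      have hpow (i : ι) : algebraMap A K (u i) ^ e j i ≠ 0 := pow_ne_zero _ (hne (hu i))
      rw [logDifferential_mul k (Finset.prod_ne_zero_iff.2 fun i _ => hpow i) (hne (hv j)),
        logDifferential_prod k _ _ fun i _ => hpow i] at h1
      refine (Submodule.add_mem_iff_right _ (sum_mem fun i _ => ?_)).1 (Submodule.mem_sup_left h1)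
      rw [logDifferential_pow k (hne (hu i))]
      exact nsmul_mem (hLu i) _
  have hLM : L ≤ M := Submodule.le_of_le_smul_of_le_jacobson_bot
    (Submodule.fg_span (Set.finite_range _))
    (IsLocalRing.jacobson_eq_maximalIdeal _ bot_ne_top).ge hL
  have hpow (i : ι) : algebraMap A K (u i) ^ n i ≠ 0 := zpow_ne_zero _ (hne (hu i))
  rw [logDifferential_mul k (hne d.ne_zero) (Finset.prod_ne_zero_iff.2 fun i _ => hpow i),
    logDifferential_prod k _ _ fun i _ => hpow i]
  refine hLM (add_mem (Submodule.smul_le_right (hunit d)) (sum_mem fun i _ => ?_))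
  rw [logDifferential_zpow k (hne (hu i))]
  have hi : logDifferential k (algebraMap A K (u i)) ∈ L :=
    Submodule.subset_span ⟨Sum.inl i, rfl⟩
  exact zsmul_mem hi _

end Differentials

/-! ### Generalizations of a point as primes of its local ring. -/

section Stalks

open IsLocalRing

variable {X : Scheme.{u}}

/-- The stalk at a generalization `z` of `x` is a localization of the stalk at `x`. -/
theorem AlgebraicGeometry.Scheme.isLocalization_stalkSpecializes {z x : X} (h : z ⤳ x) :
    letI := (X.presheaf.stalkSpecializes h).hom.toAlgebra
    IsLocalization.AtPrime (X.presheaf.stalk z)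
      ((maximalIdeal (X.presheaf.stalk z)).comap (X.presheaf.stalkSpecializes h).hom) := by
  let := (X.presheaf.stalkSpecializes h).hom.toAlgebra
  obtain ⟨_, ⟨U, hU, rfl⟩, hxU, -⟩ :=
    X.isBasis_affineOpens.exists_subset_of_mem_open (Set.mem_univ x) isOpen_univ
  have hzU : z ∈ U := h.mem_open U.2 hxU
  let : Algebra Γ(X, U) (X.presheaf.stalk x) := X.presheaf.algebra_section_stalk ⟨x, hxU⟩
  let : Algebra Γ(X, U) (X.presheaf.stalk z) := X.presheaf.algebra_section_stalk ⟨z, hzU⟩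
  have : IsScalarTower Γ(X, U) (X.presheaf.stalk x) (X.presheaf.stalk z) :=
    .of_algebraMap_eq' (by
      change _ = (X.presheaf.germ U x hxU ≫ X.presheaf.stalkSpecializes h).hom
      rw [X.presheaf.germ_stalkSpecializes]; rfl)
  have hx := hU.isLocalization_stalk ⟨x, hxU⟩
  have hz := hU.isLocalization_stalk ⟨z, hzU⟩
  have hle : (hU.primeIdealOf ⟨x, hxU⟩).asIdeal.primeCompl ≤
      (hU.primeIdealOf ⟨z, hzU⟩).asIdeal.primeCompl := fun a ha => by
    have h1 := (IsLocalization.AtPrime.isUnit_to_map_iff (X.presheaf.stalk x)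
      (hU.primeIdealOf ⟨x, hxU⟩).asIdeal a).2 ha
    have h2 := h1.map (algebraMap (X.presheaf.stalk x) (X.presheaf.stalk z))
    rw [← IsScalarTower.algebraMap_apply] at h2
    exact (IsLocalization.AtPrime.isUnit_to_map_iff (X.presheaf.stalk z)
      (hU.primeIdealOf ⟨z, hzU⟩).asIdeal a).1 h2
  have := IsLocalization.isLocalization_of_submonoid_le (X.presheaf.stalk x) (X.presheaf.stalk z)
    _ _ hle
  -- The multiplicative set may be enlarged from the image of the sections not vanishing at `z` to
  -- the full complement of the prime, whose elements are already units at `z`.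
  refine IsLocalization.of_le ((hU.primeIdealOf ⟨z, hzU⟩).asIdeal.primeCompl.map
    (algebraMap Γ(X, U) (X.presheaf.stalk x))) _ ?_ fun a ha => ?_
  · rintro _ ⟨a, ha, rfl⟩
    change ¬ algebraMap _ (X.presheaf.stalk z) _ ∈ maximalIdeal _
    rw [← IsScalarTower.algebraMap_apply, mem_maximalIdeal, mem_nonunits_iff, not_not]
    exact (IsLocalization.AtPrime.isUnit_to_map_iff (X.presheaf.stalk z)
      (hU.primeIdealOf ⟨z, hzU⟩).asIdeal a).2 ha
  · exact not_not.1 ha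

/-- The height of the prime of the stalk at `x` defined by a generalization `z`. -/
theorem AlgebraicGeometry.Scheme.height_comap_stalkSpecializes {z x : X} (h : z ⤳ x) :
    ((maximalIdeal (X.presheaf.stalk z)).comap (X.presheaf.stalkSpecializes h).hom).height =
      Order.coheight z := by
  let := (X.presheaf.stalkSpecializes h).hom.toAlgebra
  have := X.isLocalization_stalkSpecializes h
  have h1 := IsLocalization.AtPrime.ringKrullDim_eq_height
    ((maximalIdeal (X.presheaf.stalk z)).comap (X.presheaf.stalkSpecializes h).hom)
    (X.presheaf.stalk z)
  rw [ringKrullDim_stalk_eq_coheight] at h1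
  exact (WithBot.coe_injective h1).symm

/-- Every prime of the stalk at `x` is defined by a generalization of `x`. -/
theorem AlgebraicGeometry.Scheme.exists_specializes_comap_eq (x : X)
    (p : Ideal (X.presheaf.stalk x)) [hp : p.IsPrime] : ∃ (z : X) (h : z ⤳ x),
      p = (maximalIdeal (X.presheaf.stalk z)).comap (X.presheaf.stalkSpecializes h).hom := by
  let y : Spec (X.presheaf.stalk x) := ⟨p, hp⟩
  have h : X.fromSpecStalk x y ⤳ x := by
    have : X.fromSpecStalk x y ∈ Set.range (X.fromSpecStalk x) := ⟨y, rfl⟩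
    rwa [Scheme.range_fromSpecStalk] at this
  refine ⟨_, h, ?_⟩
  let c : Spec (X.presheaf.stalk (X.fromSpecStalk x y)) := closedPoint _
  -- Both points of the spectrum of the stalk at `x` map to the same point of `X`, and this map is
  -- injective.
  have h1 : X.fromSpecStalk x (Spec.map (X.presheaf.stalkSpecializes h) c) =
      X.fromSpecStalk x y := by
    rw [← Scheme.Hom.comp_apply, Scheme.SpecMap_stalkSpecializes_fromSpecStalk]
    exact Scheme.fromSpecStalk_closedPoint
  have h2 := (X.fromSpecStalk x).isEmbedding.injective h1
  exact (congr_arg PrimeSpectrum.asIdeal h2).symm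

/-- A rational function of order zero along a prime divisor is a unit of the local ring there, if
that local ring is integrally closed. -/
theorem AlgebraicGeometry.Scheme.exists_units_of_ord_eq_zero [IsIntegral X] [IsLocallyNoetherian X]
    {z : X} [IsIntegrallyClosed (X.presheaf.stalk z)] (hz : Order.coheight z = 1)
    {f : X.functionField} (hf : f ≠ 0) (h : X.ord f z = 0) :
    ∃ c : (X.presheaf.stalk z)ˣ, algebraMap (X.presheaf.stalk z) X.functionField c = f := by
  have hdim : Ring.KrullDimLE 1 (X.presheaf.stalk z) := krullDimLE_of_coheight_le hz.le
  have hfield : ¬ IsField (X.presheaf.stalk z) := fun hF => by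
    have := ringKrullDim_eq_zero_of_isField hF
    rw [ringKrullDim_stalk_eq_coheight, hz] at this
    simp at this
  have : IsDedekindDomain (X.presheaf.stalk z) :=
    { maximalOfPrime := fun h0 hp => hp.isMaximal_of_ne_bot h0 }
  have : IsDiscreteValuationRing (X.presheaf.stalk z) :=
    ((IsDiscreteValuationRing.TFAE _ hfield).out 2 0).1 this
  rw [Scheme.ord_eq_iff hz hf] at h
  -- Order `0` means value `1` of the multiplicative `Ring.ordFrac`, and in a discrete valuation
  -- ring only units have that value.
  have h1 : f ∈ MonoidHom.mker (Ring.ordFrac (X.presheaf.stalk z) (K := X.functionField)) := h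
  rw [Ring.mker_ordFrac_eq_isUnitSubmonoid] at h1
  obtain ⟨c, hc, rfl⟩ := h1
  obtain ⟨c, rfl⟩ := hc
  exact ⟨c, rfl⟩

end Stalks

/-! ### Irreducible components and their local ideals. -/

section Irreducible

variable {X : Scheme.{u}}

theorem isClosed_of_mem_componentsOf {T : Type*} [TopologicalSpace T] {Y Z : Set T}
    (hY : IsClosed Y) (hZ : Z ∈ componentsOf Y) : IsClosed Z := by
  have : closure Z ⊆ Z := hZ.2 ⟨hZ.1.1.closure, hY.closure_subset_iff.2 hZ.1.2⟩ subset_closure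
  exact isClosed_of_closure_subset this

/-- Zorn's lemma, starting from `{z}`: the union of a chain of irreducible sets is irreducible,
because any two of its points lie in a common member. -/
theorem exists_mem_componentsOf {T : Type*} [TopologicalSpace T] {Y : Set T}
    {z : T} (hz : z ∈ Y) : ∃ Z ∈ componentsOf Y, z ∈ Z := by
  obtain ⟨Z, hZz, hZ⟩ := zorn_subset_nonempty {S : Set T | IsIrreducible S ∧ S ⊆ Y}
    (fun c hc hchain hne => by
      refine ⟨⋃₀ c, ⟨⟨?_, ?_⟩, Set.sUnion_subset fun S hS => (hc hS).2⟩,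
        fun _ => Set.subset_sUnion_of_mem⟩
      · obtain ⟨S, hS⟩ := hne
        exact (hc hS).1.1.mono (Set.subset_sUnion_of_mem hS)
      · rintro U V hU hV ⟨y, ⟨P, hP, hyP⟩, hyU⟩ ⟨w, ⟨Q, hQ, hwQ⟩, hwV⟩
        rcases hchain.total hP hQ with h | h
        · obtain ⟨t, ht, htUV⟩ := (hc hQ).1.2 U V hU hV ⟨y, h hyP, hyU⟩ ⟨w, hwQ, hwV⟩
          exact ⟨t, ⟨Q, hQ, ht⟩, htUV⟩
        · obtain ⟨t, ht, htUV⟩ := (hc hP).1.2 U V hU hV ⟨y, hyP, hyU⟩ ⟨w, h hwQ, hwV⟩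
          exact ⟨t, ⟨P, hP, ht⟩, htUV⟩) {z}
    ⟨isIrreducible_singleton, Set.singleton_subset_iff.2 hz⟩
  exact ⟨Z, hZ, hZz rfl⟩

/-- The ideal at `x` of an irreducible closed subset through `x` is prime. -/
theorem isPrime_vanishingIdealAt {Z : Set X} (hZ : IsClosed Z) (hirr : IsIrreducible Z) {x : X}
    (hx : x ∈ Z) : (vanishingIdealAt Z x).IsPrime := by
  obtain ⟨η, hη⟩ := QuasiSober.sober hirr hZ
  have hηx : η ⤳ x := hη.specializes hx
  -- A germ that is a unit at a point of `Z` is a unit at the generic point `η`, so the intersection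
  -- is just the prime of `η`.
  have : vanishingIdealAt Z x = (IsLocalRing.maximalIdeal (X.presheaf.stalk η)).comap
      (X.presheaf.stalkSpecializes hηx).hom := by
    refine le_antisymm (iInf_le _ (⟨η, hη.mem, hηx⟩ : {z : X // z ∈ Z ∧ z ⤳ x})) ?_
    refine le_iInf fun ⟨z, hz, hzx⟩ a ha => ?_
    rw [Ideal.mem_comap, IsLocalRing.mem_maximalIdeal, mem_nonunits_iff] at ha ⊢
    refine fun hu => ha ?_
    have := hu.map (X.presheaf.stalkSpecializes (hη.specializes hz)).hom
    rwa [← CommRingCat.comp_apply, TopCat.Presheaf.stalkSpecializes_comp] at this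
  rw [this]
  infer_instance

end Irreducible

/-! ### Local rings of a variety as `k`-algebras. -/

namespace GVariety

open IsLocalRing

variable {k : Type u} [Field k] {G : Type v} [Group G] (V : GVariety k G)

/-- The local ring of `X` at `x` as a `k`-algebra. -/
noncomputable abbrev stalkAlgebra (x : V.X) : Algebra k (V.X.presheaf.stalk x) :=
  ((Scheme.ΓSpecIso (.of k)).inv ≫ V.π.appTop ≫ V.X.presheaf.germ ⊤ x trivial).hom.toAlgebra

/-- The sections of `X` over `U` as a `k`-algebra. -/
noncomputable abbrev sectionAlgebra (U : V.X.Opens) : Algebra k Γ(V.X, U) :=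
  ((Scheme.ΓSpecIso (.of k)).inv ≫ V.π.appLE ⊤ U le_top).hom.toAlgebra

theorem isScalarTower_stalk_functionField (x : V.X) :
    letI := V.stalkAlgebra x
    IsScalarTower k (V.X.presheaf.stalk x) V.X.functionField := by
  let := V.stalkAlgebra x
  refine .of_algebraMap_eq' ?_
  change _ = (((Scheme.ΓSpecIso (.of k)).inv ≫ V.π.appTop ≫ V.X.presheaf.germ ⊤ x trivial) ≫
    V.X.presheaf.stalkSpecializes ((genericPoint_spec V.X).specializes trivial)).hom
  have key := V.X.presheaf.germ_stalkSpecializes (U := ⊤) (y := x) trivial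
    ((genericPoint_spec V.X).specializes trivial)
  rw [Category.assoc, Category.assoc, key]
  rfl

theorem isScalarTower_section_stalk {U : V.X.Opens} (x : U) :
    letI := V.stalkAlgebra x
    letI := V.sectionAlgebra U
    IsScalarTower k Γ(V.X, U) (V.X.presheaf.stalk x.1) := by
  let := V.stalkAlgebra x
  let := V.sectionAlgebra U
  refine .of_algebraMap_eq' ?_
  change _ = (((Scheme.ΓSpecIso (.of k)).inv ≫ V.π.appLE ⊤ U le_top) ≫
    V.X.presheaf.germ U x.1 x.2).hom
  have key : V.π.appLE ⊤ U le_top ≫ V.X.presheaf.germ U x.1 x.2 =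
      V.π.appTop ≫ V.X.presheaf.germ ⊤ x.1 trivial := by
    simp only [Scheme.Hom.appLE, Category.assoc]
    rw [TopCat.Presheaf.germ_res]
    rfl
  rw [Category.assoc, key]
  rfl

theorem finiteType_section {U : V.X.Opens} (hU : IsAffineOpen U) :
    letI := V.sectionAlgebra U
    Algebra.FiniteType k Γ(V.X, U) := by
  let := V.sectionAlgebra U
  have h := V.π.finiteType_appLE (isAffineOpen_top _) hU le_top
  exact h.comp (RingHom.FiniteType.of_surjective (Scheme.ΓSpecIso (.of k)).inv.hom
    (ConcreteCategory.bijective_of_isIso (Scheme.ΓSpecIso (.of k)).inv).2)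

theorem smooth_section [Smooth V.π] {U : V.X.Opens} (hU : IsAffineOpen U) :
    letI := V.sectionAlgebra U
    Algebra.Smooth k Γ(V.X, U) := by
  let := V.sectionAlgebra U
  have h := V.π.smooth_appLE (isAffineOpen_top _) hU le_top
  exact (RingHom.Smooth.of_bijective (f := (Scheme.ΓSpecIso (.of k)).inv.hom)
    (ConcreteCategory.bijective_of_isIso (Scheme.ΓSpecIso (.of k)).inv)).comp h

theorem essFiniteType_stalk (x : V.X) :
    letI := V.stalkAlgebra x
    Algebra.EssFiniteType k (V.X.presheaf.stalk x) := by
  let := V.stalkAlgebra x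
  obtain ⟨_, ⟨U, hU, rfl⟩, hxU, -⟩ :=
    V.X.isBasis_affineOpens.exists_subset_of_mem_open (Set.mem_univ x) isOpen_univ
  let := V.sectionAlgebra U
  let : Algebra Γ(V.X, U) (V.X.presheaf.stalk x) := V.X.presheaf.algebra_section_stalk ⟨x, hxU⟩
  have := V.isScalarTower_section_stalk ⟨x, hxU⟩
  have := V.finiteType_section hU
  have := hU.isLocalization_stalk ⟨x, hxU⟩
  have : Algebra.EssFiniteType Γ(V.X, U) (V.X.presheaf.stalk x) :=
    .of_isLocalization _ (hU.primeIdealOf ⟨x, hxU⟩).asIdeal.primeCompl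
  exact .comp k Γ(V.X, U) (V.X.presheaf.stalk x)

theorem isIntegrallyClosed_stalk [Smooth V.π] (x : V.X) :
    IsIntegrallyClosed (V.X.presheaf.stalk x) := by
  obtain ⟨_, ⟨U, hU, rfl⟩, hxU, -⟩ :=
    V.X.isBasis_affineOpens.exists_subset_of_mem_open (Set.mem_univ x) isOpen_univ
  let := V.sectionAlgebra U
  let : Algebra Γ(V.X, U) (V.X.presheaf.stalk x) := V.X.presheaf.algebra_section_stalk ⟨x, hxU⟩
  have := V.smooth_section hU
  have := hU.isLocalization_stalk ⟨x, hxU⟩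
  have : Nonempty U := ⟨⟨x, hxU⟩⟩
  have : IsIntegrallyClosed Γ(V.X, U) := .of_smooth k _
  exact isIntegrallyClosed_of_isLocalization (V.X.presheaf.stalk x)
    (hU.primeIdealOf ⟨x, hxU⟩).asIdeal.primeCompl
    (Ideal.primeCompl_le_nonZeroDivisors _)

/-- Zariski's lemma: a closed point is a maximal ideal of an affine chart, so its residue field is a
finitely generated `k`-algebra, hence finite over `k`. -/
theorem isAlgebraic_residueField {x : V.X} (hx : IsClosed ({x} : Set V.X)) :
    letI := V.stalkAlgebra x
    Algebra.IsAlgebraic k (ResidueField (V.X.presheaf.stalk x)) := by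
  let := V.stalkAlgebra x
  obtain ⟨_, ⟨U, hU, rfl⟩, hxU, -⟩ :=
    V.X.isBasis_affineOpens.exists_subset_of_mem_open (Set.mem_univ x) isOpen_univ
  let := V.sectionAlgebra U
  let : Algebra Γ(V.X, U) (V.X.presheaf.stalk x) := V.X.presheaf.algebra_section_stalk ⟨x, hxU⟩
  have := V.isScalarTower_section_stalk ⟨x, hxU⟩
  have := V.finiteType_section hU
  have := hU.isLocalization_stalk ⟨x, hxU⟩
  let q := (hU.primeIdealOf ⟨x, hxU⟩).asIdeal
  have hq : q.IsMaximal := hU.primeIdealOf_isMaximal_of_isClosed ⟨x, hxU⟩ hx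
  have hsurj : Function.Surjective (algebraMap Γ(V.X, U) (ResidueField (V.X.presheaf.stalk x))) := by
    intro y
    obtain ⟨r, hr⟩ := (IsLocalization.AtPrime.equivQuotMaximalIdeal q
      (V.X.presheaf.stalk x)).surjective y
    obtain ⟨r, rfl⟩ := Ideal.Quotient.mk_surjective r
    exact ⟨r, hr⟩
  have : Algebra.FiniteType k (ResidueField (V.X.presheaf.stalk x)) :=
    Algebra.FiniteType.of_surjective
      (IsScalarTower.toAlgHom k Γ(V.X, U) (ResidueField (V.X.presheaf.stalk x))) hsurj
  have : Module.Finite k (ResidueField (V.X.presheaf.stalk x)) :=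
    finite_of_finite_type_of_isJacobsonRing _ _
  infer_instance

end GVariety

/-! ### Functoriality of pullback of germs. -/

section GermPullback

open IsLocalRing

variable {X : Scheme.{u}}

theorem germPullback_congr {φ ψ : X ⟶ X} (e : φ = ψ) {x y : X} (h : φ x = y) (h' : ψ x = y) :
    germPullback φ h = germPullback ψ h' := by
  subst e; rfl

theorem germPullback_germPullback (φ ψ : X ⟶ X) {x y z : X} (h : φ x = y) (h' : ψ y = z)
    (h'' : (φ ≫ ψ) x = z) (t : X.presheaf.stalk z) :
    germPullback φ h (germPullback ψ h' t) = germPullback (φ ≫ ψ) h'' t := by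
  subst h h'
  simp only [germPullback, ← CommRingCat.comp_apply]
  simp [Scheme.Hom.stalkMap_comp]

theorem germPullback_id {x : X} (h : (𝟙 X : X ⟶ X) x = x) (t : X.presheaf.stalk x) :
    germPullback (𝟙 X) h t = t := by
  simp [germPullback]

/-- Taken at the generic point, this identifies pullback of germs with pullback of rational
functions. -/
theorem stalkSpecializes_germPullback (φ : X ⟶ X) {z x w y : X} (h : φ x = y) (hw : φ z = w)
    (hzx : z ⤳ x) (hwy : w ⤳ y) (t : X.presheaf.stalk y) :
    X.presheaf.stalkSpecializes hzx (germPullback φ h t) =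
      germPullback φ hw (X.presheaf.stalkSpecializes hwy t) := by
  subst h hw
  simp only [germPullback, ← CommRingCat.comp_apply]
  congr 2
  rw [Category.assoc, ← Scheme.Hom.stalkSpecializes_stalkMap,
    TopCat.Presheaf.stalkSpecializes_comp_assoc, TopCat.Presheaf.stalkSpecializes_comp_assoc]

theorem germPullback_bijective (φ : X ⟶ X) [IsIso φ] {x y : X} (h : φ x = y) :
    Function.Bijective (germPullback φ h) := by
  subst h
  have : IsIso (X.presheaf.stalkSpecializes (specializes_of_eq (rfl : φ x = φ x)) ≫
      φ.stalkMap x) := by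
    rw [TopCat.Presheaf.stalkSpecializes_refl]
    infer_instance
  exact ConcreteCategory.bijective_of_isIso _

/-- An automorphism matches the generalizations of `x` in `Z` with those of `y` in `φ '' Z`, and its
isomorphisms of stalks preserve non-units. -/
theorem mem_vanishingIdealAt_image (φ : X ⟶ X) [IsIso φ] {x y : X} (h : φ x = y) (Z : Set X)
    (t : X.presheaf.stalk y) :
    t ∈ vanishingIdealAt (φ '' Z) y ↔ germPullback φ h t ∈ vanishingIdealAt Z x := by
  have hspec (z : X) : φ z ⤳ y ↔ z ⤳ x := by
    rw [← h]
    exact φ.isOpenEmbedding.isInducing.specializes_iff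
  simp only [vanishingIdealAt, Ideal.mem_iInf, Ideal.mem_comap, Subtype.forall]
  have key (z : X) (hzx : z ⤳ x) (hwy : φ z ⤳ y) :
      (X.presheaf.stalkSpecializes hwy).hom t ∈ maximalIdeal (X.presheaf.stalk (φ z)) ↔
      (X.presheaf.stalkSpecializes hzx).hom (germPullback φ h t) ∈
        maximalIdeal (X.presheaf.stalk z) := by
    have e := stalkSpecializes_germPullback φ h rfl hzx hwy t
    have hb := germPullback_bijective φ (rfl : φ z = φ z)
    rw [mem_maximalIdeal, mem_maximalIdeal, mem_nonunits_iff, mem_nonunits_iff, not_iff_not]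
    refine Iff.trans ?_ (iff_of_eq (congr_arg IsUnit e.symm))
    exact (MulEquiv.isUnit_map (RingEquiv.ofBijective _ hb)).symm
  constructor
  · rintro H z ⟨hz, hzx⟩
    exact (key z hzx ((hspec z).2 hzx)).1 (H (φ z) ⟨⟨z, hz, rfl⟩, (hspec z).2 hzx⟩)
  · rintro H _ ⟨⟨z, hz, rfl⟩, hzy⟩
    exact (key z ((hspec z).1 hzy) hzy).2 (H z ⟨hz, (hspec z).1 hzy⟩)

theorem span_germPullback_eq_vanishingIdealAt (φ : X ⟶ X) [IsIso φ] {x y : X} (h : φ x = y)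
    (Z : Set X) (t : X.presheaf.stalk y) (ht : Ideal.span {t} = vanishingIdealAt (φ '' Z) y) :
    Ideal.span {germPullback φ h t} = vanishingIdealAt Z x := by
  ext a
  obtain ⟨b, rfl⟩ := (germPullback_bijective φ h).2 a
  rw [← mem_vanishingIdealAt_image, ← ht, Ideal.mem_span_singleton, Ideal.mem_span_singleton]
  exact map_dvd_iff (RingEquiv.ofBijective _ (germPullback_bijective φ h))

end GermPullback

/-! ### Adapted coordinates, invariant functions and the conclusion. -/

namespace GVariety

open IsLocalRing

variable {k : Type u} [Field k] {G : Type v} [Group G] (V : GVariety k G)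

theorem act_mul_hom (g h : G) : (V.act (g * h)).hom = (V.act h).hom ≫ (V.act g).hom := by
  rw [map_mul]; rfl

theorem act_one_hom : (V.act 1).hom = 𝟙 V.X := by
  rw [map_one]; rfl

/-- Pullback is contravariant, so the left action on `X` becomes a right action on functions. -/
theorem ratPullback_ratPullback (g h : G) (f : V.X.functionField) :
    V.ratPullback h (V.ratPullback g f) = V.ratPullback (g * h) f := by
  have e := V.act_mul_hom g h
  refine (germPullback_germPullback _ _ _ _ ?_ f).trans ?_
  · rw [← e]; exact genericPoint_eq_of_isOpenImmersion _
  · exact congr($(germPullback_congr e.symm _ _) f)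

theorem ratPullback_one (f : V.X.functionField) : V.ratPullback 1 f = f := by
  refine (congr($(germPullback_congr V.act_one_hom _ (by simp)) f)).trans ?_
  exact germPullback_id _ f

theorem toRat_germPullback (g : G) {x y : V.X} (h : (V.act g).hom x = y)
    (t : V.X.presheaf.stalk y) :
    V.toRat x (germPullback (V.act g).hom h t) = V.ratPullback g (V.toRat y t) :=
  stalkSpecializes_germPullback _ _ _ _ _ t

theorem toRat_injective (x : V.X) : Function.Injective (V.toRat x) :=
  IsFractionRing.injective (V.X.presheaf.stalk x) V.X.functionField

theorem toRat_stalkSpecializes {z x : V.X} (h : z ⤳ x) (t : V.X.presheaf.stalk x) :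
    V.toRat z (V.X.presheaf.stalkSpecializes h t) = V.toRat x t := by
  change (V.X.presheaf.stalkSpecializes h ≫ V.X.presheaf.stalkSpecializes _) t = _
  rw [TopCat.Presheaf.stalkSpecializes_comp]
  rfl

section Coordinates

variable {V} {Y : Set V.X} {x : V.X} {m l : ℕ} {Ys : Fin m → Set V.X}
  {u : Fin m → maximalIdeal (V.X.presheaf.stalk x)}
  {v : Fin l → maximalIdeal (V.X.presheaf.stalk x)} {e : Fin l → Fin m → ℕ}

theorem IsAdaptedCoordinateSystem.coordinate_ne_zero (H : V.IsAdaptedCoordinateSystem Y x Ys u v e)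
    (i : Fin m ⊕ Fin l) :
    ((Sum.elim u v i : maximalIdeal _) : V.X.presheaf.stalk x) ≠ 0 := fun h => by
  refine H.coordinates.1.ne_zero i ?_
  have h0 : (Sum.elim u v i : maximalIdeal (V.X.presheaf.stalk x)) = 0 := Subtype.ext h
  rw [h0, map_zero]

theorem IsAdaptedCoordinateSystem.u_ne_zero (H : V.IsAdaptedCoordinateSystem Y x Ys u v e)
    (i : Fin m) : (u i : V.X.presheaf.stalk x) ≠ 0 :=
  H.coordinate_ne_zero (Sum.inl i)

theorem IsAdaptedCoordinateSystem.v_ne_zero (H : V.IsAdaptedCoordinateSystem Y x Ys u v e)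
    (j : Fin l) : (v j : V.X.presheaf.stalk x) ≠ 0 :=
  H.coordinate_ne_zero (Sum.inr j)

/-- Since `u i` is an equation of `g(Ys i)` at `g x`, transporting it back by `g` gives an equation
of `Ys i` at `x`. All the `g^*(u i)` thus generate the same ideal. -/
theorem IsAdaptedCoordinateSystem.exists_ratPullback_eq
    (H : V.IsAdaptedCoordinateSystem Y x Ys u v e) (i : Fin m) (g : G) :
    ∃ s : V.X.presheaf.stalk x, V.toRat x s = V.ratPullback g (V.toRat x (u i)) ∧
      Ideal.span {s} = vanishingIdealAt (Ys i) x := by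
  obtain ⟨t, ht, hspan⟩ := H.local_equation i g
  refine ⟨germPullback (V.act g).hom rfl t, ?_, ?_⟩
  · rw [toRat_germPullback, ht]
  · exact span_germPullback_eq_vanishingIdealAt _ _ _ _ hspan

theorem IsAdaptedCoordinateSystem.span_u_eq (H : V.IsAdaptedCoordinateSystem Y x Ys u v e)
    (i : Fin m) : Ideal.span {(u i : V.X.presheaf.stalk x)} = vanishingIdealAt (Ys i) x := by
  obtain ⟨s, hs, hspan⟩ := H.exists_ratPullback_eq i 1
  rw [ratPullback_one] at hs
  rwa [V.toRat_injective x hs] at hspan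

theorem IsAdaptedCoordinateSystem.prime_u (H : V.IsAdaptedCoordinateSystem Y x Ys u v e)
    (hY : IsClosed Y) (i : Fin m) : Prime (u i : V.X.presheaf.stalk x) := by
  rw [← Ideal.span_singleton_prime (H.u_ne_zero i), H.span_u_eq]
  obtain ⟨hZ, hx⟩ : Ys i ∈ {Z | Z ∈ componentsOf Y ∧ x ∈ Z} := H.components_range ▸ ⟨i, rfl⟩
  exact isPrime_vanishingIdealAt (isClosed_of_mem_componentsOf hY hZ) hZ.1.1 hx

theorem IsAdaptedCoordinateSystem.exists_wFun_eq [Fintype G]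
    (H : V.IsAdaptedCoordinateSystem Y x Ys u v e) (i : Fin m) :
    ∃ c : (V.X.presheaf.stalk x)ˣ,
      V.wFun u i = V.toRat x c * V.toRat x (u i) ^ Fintype.card G := by
  have h (g : G) : ∃ c : (V.X.presheaf.stalk x)ˣ,
      V.ratPullback g (V.toRat x (u i)) = V.toRat x c * V.toRat x (u i) := by
    obtain ⟨s, hs, hspan⟩ := H.exists_ratPullback_eq i g
    rw [← H.span_u_eq, Ideal.span_singleton_eq_span_singleton] at hspan
    obtain ⟨c, hc⟩ := hspan.symm
    exact ⟨c, by rw [← hs, ← hc, map_mul, mul_comm]⟩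
  choose c hc using h
  refine ⟨∏ g, c g, ?_⟩
  rw [wFun, Finset.prod_congr rfl fun g _ => hc g, Finset.prod_mul_distrib, Finset.prod_const,
    Finset.card_univ, Units.coe_prod, map_prod]

theorem wFun_ne_zero [Fintype G] (H : V.IsAdaptedCoordinateSystem Y x Ys u v e) (i : Fin m) :
    V.wFun u i ≠ 0 :=
  Finset.prod_ne_zero_iff.2 fun _ _ => (map_ne_zero _).2
    ((map_ne_zero_iff _ (V.toRat_injective x)).2 (H.u_ne_zero i))

theorem hFun_ne_zero (H : V.IsAdaptedCoordinateSystem Y x Ys u v e) (j : Fin l) :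
    V.hFun u v e j ≠ 0 :=
  mul_ne_zero (Finset.prod_ne_zero_iff.2 fun i _ => pow_ne_zero _
      ((map_ne_zero_iff _ (V.toRat_injective x)).2 (H.u_ne_zero i)))
    ((map_ne_zero_iff _ (V.toRat_injective x)).2 (H.v_ne_zero j))

theorem ratPullback_wFun [Fintype G] (i : Fin m) (g : G) :
    V.ratPullback g (V.wFun u i) = V.wFun u i := by
  rw [wFun, map_prod]
  simp only [ratPullback_ratPullback]
  exact Fintype.prod_equiv (Equiv.mulRight g) _ _ fun _ => rfl

/-- A rational function whose divisor is supported on `Y` is near `x` a unit times a monomial in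
the equations of the components of `Y`. -/
theorem IsAdaptedCoordinateSystem.exists_eq_unit_mul_prod_zpow [Smooth V.π]
    (H : V.IsAdaptedCoordinateSystem Y x Ys u v e) (hY : IsClosed Y) {f : V.X.functionField}
    (hf : f ≠ 0) (hfY : V.DivisorSupportedOn f Y) :
    ∃ (c : (V.X.presheaf.stalk x)ˣ) (n : Fin m → ℤ),
      f = V.toRat x c * ∏ i, V.toRat x (u i) ^ n i := by
  have := V.isIntegrallyClosed_stalk x
  refine IsIntegrallyClosed.exists_unit_mul_prod_zpow (fun i => (u i : V.X.presheaf.stalk x))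
    (H.prime_u hY) f hf fun p hp h1 hup => ?_
  obtain ⟨z, hzx, rfl⟩ := V.X.exists_specializes_comap_eq x p
  rw [Scheme.height_comap_stalkSpecializes] at h1
  -- If the order were nonzero, `z` would lie on a component of `Y`; being closed, it contains `x`,
  -- so it is some `Ys i`, and `u i` would vanish at `z`.
  have hord : V.X.ord f z = 0 := by
    by_contra hne
    obtain ⟨Z, hZ, hzZ⟩ := exists_mem_componentsOf (hfY z h1 hne)
    have hxZ : x ∈ Z := hzx.mem_closed (isClosed_of_mem_componentsOf hY hZ) hzZ
    obtain ⟨i, rfl⟩ : Z ∈ Set.range Ys := H.components_range ▸ ⟨hZ, hxZ⟩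
    refine hup i ?_
    have hmem : (u i : V.X.presheaf.stalk x) ∈ vanishingIdealAt (Ys i) x :=
      H.span_u_eq i ▸ Ideal.mem_span_singleton_self _
    exact (Ideal.mem_iInf.1 hmem) ⟨z, hzZ, hzx⟩
  have := V.isIntegrallyClosed_stalk z
  obtain ⟨c, rfl⟩ := Scheme.exists_units_of_ord_eq_zero h1 hf hord
  let := (V.X.presheaf.stalkSpecializes hzx).hom.toAlgebra
  have hloc := V.X.isLocalization_stalkSpecializes hzx
  -- The unit at `z` is a fraction `a / s` of germs at `x` with `s` outside the prime of `z`; then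
  -- `a = c * s` is also a unit at `z`.
  obtain ⟨⟨a, s⟩, hs⟩ := IsLocalization.surj
    ((maximalIdeal (V.X.presheaf.stalk z)).comap
      (V.X.presheaf.stalkSpecializes hzx).hom).primeCompl (c : V.X.presheaf.stalk z)
  refine ⟨a, fun ha => ?_, s, s.2, ?_⟩
  · have hu : IsUnit ((c : V.X.presheaf.stalk z) *
        algebraMap (V.X.presheaf.stalk x) (V.X.presheaf.stalk z) s) :=
      c.isUnit.mul (IsLocalization.map_units _ s)
    rw [hs] at hu
    exact (mem_nonunits_iff.1 ha) hu
  · have h1 : V.toRat z (algebraMap (V.X.presheaf.stalk x) (V.X.presheaf.stalk z) s) =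
      V.toRat x s := V.toRat_stalkSpecializes hzx s
    have h2 : V.toRat z (algebraMap (V.X.presheaf.stalk x) (V.X.presheaf.stalk z) a) =
      V.toRat x a := V.toRat_stalkSpecializes hzx a
    change V.toRat x s * V.toRat z c = V.toRat x a
    rw [← h1, ← h2, ← hs, map_mul, mul_comm]

end Coordinates

end GVariety

/-- Passes from `A`-spans, natural for Nakayama, to spans over the image of `A` in `K`. -/
theorem Submodule.mem_span_range_algebraMap {A K M : Type*} [CommRing A] [CommRing K] [Algebra A K]
    [AddCommGroup M] [Module A M] [Module K M] [IsScalarTower A K M] {s : Set M} {ω : M}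
    (h : ω ∈ Submodule.span A s) : ω ∈ Submodule.span (algebraMap A K).range s := by
  induction h using Submodule.span_induction with
  | mem ω hω => exact Submodule.subset_span hω
  | zero => exact zero_mem _
  | add a b _ _ ha hb => exact add_mem ha hb
  | smul a ω _ hω =>
    rw [← algebraMap_smul K a ω]
    exact Submodule.smul_mem _ (⟨algebraMap A K a, a, rfl⟩ : (algebraMap A K).range) hω

theorem lemma4p6 {k : Type u} [Field k] [CharZero k] {G : Type v} [Group G] [Fintype G]
    (V : GVariety k G) (hqp : V.IsQuasiprojective)
    (Y : Set V.X) (hY : V.IsStandardForm Y)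
    (x : V.X) (hx : IsClosed ({x} : Set V.X))
    {m l : ℕ} (Ys : Fin m → Set V.X)
    (u : Fin m → IsLocalRing.maximalIdeal (V.X.presheaf.stalk x))
    (v : Fin l → IsLocalRing.maximalIdeal (V.X.presheaf.stalk x))
    (e : Fin l → Fin m → ℕ)
    (hcoord : V.IsAdaptedCoordinateSystem Y x Ys u v e)
    (f : V.X.functionField) (hf : f ≠ 0) (hfY : V.DivisorSupportedOn f Y) :
    (∀ i, V.wFun u i ≠ 0 ∧ ∀ g : G, V.ratPullback g (V.wFun u i) = V.wFun u i) ∧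
    (∀ j, V.hFun u v e j ≠ 0 ∧ ∀ g : G, V.ratPullback g (V.hFun u v e j) = V.hFun u v e j) ∧
    V.dlog f ∈ Submodule.span (V.toRat x).range
      (Set.range (fun i => V.dlog (V.wFun u i)) ∪
        Set.range (fun j => V.dlog (V.hFun u v e j))) := by
  refine ⟨fun i => ⟨GVariety.wFun_ne_zero hcoord i, GVariety.ratPullback_wFun i⟩,
    fun j => ⟨GVariety.hFun_ne_zero hcoord j, hcoord.invariant_h j⟩, ?_⟩
  have := hY.smooth
  obtain ⟨d, n, hd⟩ := hcoord.exists_eq_unit_mul_prod_zpow hY.normal_crossing.1 hf hfY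
  choose c hc using hcoord.exists_wFun_eq
  let := V.stalkAlgebra x
  have := V.isScalarTower_stalk_functionField x
  have := V.essFiniteType_stalk x
  have := V.isAlgebraic_residueField hx
  -- Here `N` is the order of `G`.
  have key := logDifferential_mem_span (k := k) (K := V.X.functionField) u v
    hcoord.u_ne_zero hcoord.v_ne_zero hcoord.coordinates.2 (Fintype.card_ne_zero (α := G)) c e d n
  change logDifferential k (V.toRat x d * ∏ i, V.toRat x (u i) ^ n i) ∈ Submodule.span _
    (Set.range (fun i => logDifferential k (V.toRat x (c i) * V.toRat x (u i) ^ Fintype.card G)) ∪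
      Set.range (fun j => V.dlog (V.hFun u v e j))) at key
  simp only [← hd, ← hc] at key
  exact Submodule.mem_span_range_algebraMap key
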